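/- Let $K$ be a field of characteristic zero and let $K((\mathbb{R}))$ be the Hahn field of formal sums $b=\sum_{x\in\mathbb{R}} k_x t^x$ with $k_x\in K$ whose support $\operatorname{supp}(b)=\{x\in\mathbb{R} : k_x\neq 0\}$ is well-ordered. Let $K((\mathbb{R}^{\leq 0}))$ be the subring of the series whose support is contained in $\mathbb{R}^{\leq 0}=\{x\in\mathbb{R}: x\leq 0\}$, and let $K((\mathbb{R}^{\leq 0}))^*=K((\mathbb{R}^{\leq 0}))\setminus\{0\}$. For $b\in K((\mathbb{R}))$ let $\sup(b)\in\mathbb{R}\cup\{\pm\infty\}$ be the supremum of $\operatorname{supp}(b)$; in particular $\sup(0)=-\infty$. Then $\sup$ is a valuation on $K((\mathbb{R}^{\leq 0}))$: it maps $K((\mathbb{R}^{\leq 0}))^*$ into $\mathbb{R}^{\leq 0}$, it takes the value $-\infty$ on $K((\mathbb{R}^{\leq 0}))$ only at $0$, and for all $b, c\in K((\mathbb{R}^{\leq 0}))^*$ we have - $\sup(b+c)\leq\max\{\sup(b),\sup(c)\}$; - $\sup(bc)=\sup(b)+\sup(c)$. -/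

import Mathlib

/-- `K((ℝ^{≤0}))`: the subring of the Hahn field `K((ℝ))` consisting of the series all of whose
exponents are non-positive. -/
def nonposSeries (K : Type*) [Field K] : Subring (HahnSeries ℝ K) where
  carrier := {b | b.support ⊆ Set.Iic 0}
  mul_mem' := by
    intro b c hb hc x hx
    obtain ⟨y, hy, z, hz, rfl⟩ := Set.mem_add.1 (HahnSeries.support_mul_subset hx)
    exact add_nonpos (Set.mem_Iic.1 (hb hy)) (Set.mem_Iic.1 (hc hz))
  one_mem' := by
    intro x hx
    by_contra h
    exact hx (by
      have : x ≠ 0 := fun h0 => h (by simp [h0])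
      simp [HahnSeries.coeff_one, this])
  add_mem' := by
    intro b c hb hc x hx
    rcases HahnSeries.support_add_subset b c hx with h | h
    · exact hb h
    · exact hc h
  zero_mem' := by
    intro x hx
    exact absurd rfl hx
  neg_mem' := by
    intro b hb x hx
    refine hb (fun h => hx ?_)
    simp [h]

/-- The supremum of a series `b ∈ K((ℝ))`: the supremum of its support, taken in the extended real
line, so that the supremum of the zero series is `-∞`. -/
noncomputable def supSeries {K : Type*} [Field K] (b : HahnSeries ℝ K) : EReal :=
  sSup ((fun x : ℝ => (x : EReal)) '' b.support)

open Filter Topology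

/-! ### Ordinals in Cantor normal form under natural sum; `single m 1` stands for ω^m. -/

namespace Finsupp.Colex

/-! The only hard claim is sup(bc) = sup(b) + sup(c): suprema need not be attained, so terms near
the top of the product might cancel. Multiplying by powers of t moves both suprema to 0, and it
remains to show that the series with negative supremum form a prime ideal (`mul_notMem_negligible`).

Modulo this ideal, germs obey a finite convolution formula: `germ g (b * c)` is the sum of the `germ
u b * germ (g - u) c` (`germ_mul_sub_sum_mem`). The rank of a non-negligible b is the least ordinal
strictly above the ranks of its non-negligible germs at all g < 0 close enough to 0. Ranks add
exactly under natural sum (`HasRank.mul`), so a product of non-negligible series has a rank and is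
not negligible.

That the rank of a product is at most the sum follows by induction from the convolution formula. For
equality, the formula becomes a Leibniz rule modulo lower rank: the germ of b^(n+1) c is b^(n+1)
germ(c) + (n+1) germ(b) b^n c. If the rank of b^(n+1) c dropped, then, after another multiplication
by b or a division by n+1 (characteristic zero), one summand alone would have too small a rank,
against an induction hypothesis. -/

theorem exists_eq_add_single {α : Type*} {m : α} {a : Colex (α →₀ ℕ)} (hm : ofColex a m ≠ 0) :
    ∃ a₀, a = a₀ + toColex (single m 1) := by
  refine ⟨toColex (ofColex a - single m 1), ?_⟩
  change ofColex a = ofColex a - single m 1 + single m 1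
  rw [tsub_add_cancel_of_le]
  rw [Finsupp.single_le_iff]
  omega

variable {α : Type*} [LinearOrder α]

theorem lt_single_iff {m : α} {x : Colex (α →₀ ℕ)} :
    x < toColex (single m 1) ↔ ∀ k, m ≤ k → ofColex x k = 0 := by
  rw [Colex.lt_iff]
  constructor
  · rintro ⟨i, h, hi⟩ k hk
    change ∀ j, i < j → ofColex x j = single m 1 j at h
    change ofColex x i < single m 1 i at hi
    have him : m = i := by
      by_contra hne
      simp [hne] at hi
    subst him
    rcases hk.eq_or_lt with rfl | hk
    · simpa using hi
    · rw [h k hk, single_apply, if_neg hk.ne]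
  · intro h
    refine ⟨m, fun j hj => ?_, ?_⟩
    · change ofColex x j = single m 1 j
      rw [h j hj.le, single_apply, if_neg hj.ne]
    · change ofColex x m < single m 1 m
      simp [h m le_rfl]

theorem add_lt_single {m : α} {x y : Colex (α →₀ ℕ)} (hx : x < toColex (single m 1))
    (hy : y < toColex (single m 1)) : x + y < toColex (single m 1) := by
  rw [lt_single_iff] at *
  intro k hk
  change ofColex x k + ofColex y k = 0
  rw [hx k hk, hy k hk]

/-- Every exponent of a is at least m, so x can only be smaller than a by a whole ω^m, up to the
part r of x with exponents below m. -/
theorem add_single_le_of_lt {m : α} {a x : Colex (α →₀ ℕ)}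
    (hm : ∀ k, ofColex a k ≠ 0 → m ≤ k) (hx : x < a) :
    ∃ r < toColex (single m 1), x + toColex (single m 1) ≤ a + r := by
  obtain ⟨e, he, hlt⟩ := Colex.lt_iff.1 hx
  change ∀ j, e < j → ofColex x j = ofColex a j at he
  change ofColex x e < ofColex a e at hlt
  refine ⟨toColex ((ofColex x).filter (· < m)), ?_, ?_⟩
  · rw [lt_single_iff]
    intro k hk
    exact filter_apply_neg _ _ (not_lt.2 hk)
  · rcases (hm e (by omega)).eq_or_lt with rfl | hme
    · apply toColex_monotone
      intro k
      change ofColex x k + single m 1 k ≤ ofColex a k + ((ofColex x).filter (· < m)) k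
      rcases lt_trichotomy k m with h | rfl | h
      · rw [filter_apply_pos (· < m) _ h, single_apply, if_neg h.ne']
        omega
      · rw [single_eq_same]
        omega
      · rw [he k h, single_apply, if_neg h.ne]
        omega
    · refine le_of_lt (Colex.lt_iff.2 ⟨e, fun j hj => ?_, ?_⟩)
      · change ofColex x j + single m 1 j = ofColex a j + ((ofColex x).filter (· < m)) j
        rw [he j hj, single_apply, if_neg (hme.trans hj).ne,
          filter_apply_neg (· < m) _ (not_lt.2 (hme.trans hj).le)]
      · change ofColex x e + single m 1 e < ofColex a e + ((ofColex x).filter (· < m)) e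
        rw [single_apply, if_neg hme.ne]
        omega

theorem exists_min_support {a : Colex (α →₀ ℕ)} (ha : a ≠ 0) :
    ∃ m, ofColex a m ≠ 0 ∧ ∀ k, ofColex a k ≠ 0 → m ≤ k := by
  have hne : (ofColex a).support.Nonempty := by
    rw [support_nonempty_iff]
    exact ha
  refine ⟨(ofColex a).support.min' hne, ?_, fun k hk => ?_⟩
  · exact mem_support_iff.1 (Finset.min'_mem _ hne)
  · exact Finset.min'_le _ _ (mem_support_iff.2 hk)

/-- Going below a natural sum means lowering one summand: the one that contains the lowest exponent
m of a + b can give up an ω^m. -/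
theorem exists_le_add_of_lt_add {a b x : Colex (α →₀ ℕ)} (hx : x < a + b) :
    (∃ a' < a, x ≤ a' + b) ∨ ∃ b' < b, x ≤ a + b' := by
  have key : ∀ {a b : Colex (α →₀ ℕ)}, x < a + b → ∀ m, ofColex a m ≠ 0 →
      (∀ k, ofColex (a + b) k ≠ 0 → m ≤ k) → ∃ a' < a, x ≤ a' + b := by
    intro a b hx m hma hm
    obtain ⟨r, hr, hle⟩ := add_single_le_of_lt hm hx
    obtain ⟨a₀, rfl⟩ := exists_eq_add_single hma
    refine ⟨a₀ + r, by gcongr, ?_⟩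
    rw [← add_le_add_iff_right (toColex (single m 1))]
    exact hle.trans_eq (by abel)
  obtain ⟨m, hm, hmin⟩ := exists_min_support (a := a + b) (by
    rintro h
    rw [h] at hx
    exact not_lt_zero hx)
  by_cases hma : ofColex a m = 0
  · right
    have hmb : ofColex b m ≠ 0 := by
      intro hmb
      apply hm
      change ofColex a m + ofColex b m = 0
      rw [hma, hmb]
    rw [add_comm] at hx hmin
    obtain ⟨b', hb', hle⟩ := key hx m hmb hmin
    exact ⟨b', hb', by rwa [add_comm]⟩
  · exact Or.inl (key hx m hma hmin)

theorem exists_le_nsmul_add_of_lt {a b x : Colex (α →₀ ℕ)} {n : ℕ} (hx : x < n • a + b) :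
    (∃ a' < a, ∃ k, n = k + 1 ∧ x ≤ a' + (k • a + b)) ∨ ∃ b' < b, x ≤ n • a + b' := by
  induction n generalizing x with
  | zero => exact Or.inr ⟨x, by simpa using hx, by simp⟩
  | succ n ih =>
    rw [succ_nsmul', add_assoc] at hx
    rcases exists_le_add_of_lt_add hx with ⟨a', ha', h⟩ | ⟨z, hz, h⟩
    · exact Or.inl ⟨a', ha', n, rfl, h⟩
    · rcases ih hz with ⟨a', ha', k, rfl, h'⟩ | ⟨b', hb', h'⟩
      · refine Or.inl ⟨a', ha', k + 1, rfl, h.trans ?_⟩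
        calc a + z ≤ a + (a' + (k • a + b)) := by gcongr
          _ = a' + ((k + 1) • a + b) := by rw [succ_nsmul']; abel
      · refine Or.inr ⟨b', hb', h.trans ?_⟩
        calc a + z ≤ a + (n • a + b') := by gcongr
          _ = _ := by rw [succ_nsmul']; abel

theorem exists_lt_add_forall_add_lt {a : Colex (α →₀ ℕ)} (ha : a ≠ 0) (b : Colex (α →₀ ℕ)) :
    ∃ t < a + b, ∀ a' < a, ∀ b' < b, a' + b' < t := by
  rcases eq_or_ne b 0 with rfl | hb
  · exact ⟨0, by simpa using pos_iff_ne_zero.2 ha, fun _ _ b' hb' => absurd hb' not_lt_zero⟩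
  have key : ∀ {a b : Colex (α →₀ ℕ)} (m n : α), m ≤ n → ofColex a m ≠ 0 → ofColex b n ≠ 0 →
      (∀ k, ofColex a k ≠ 0 → m ≤ k) → (∀ k, ofColex b k ≠ 0 → n ≤ k) →
      ∃ t < a + b, ∀ a' < a, ∀ b' < b, a' + b' < t := by
    intro a b m n hmn ham hbn hm hn
    obtain ⟨a₀, rfl⟩ := exists_eq_add_single ham
    obtain ⟨b₀, rfl⟩ := exists_eq_add_single hbn
    -- The smaller lowest term ω^m is dropped from a + b; the remainders r and s together stay below
    -- the ω^n that is kept.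
    refine ⟨a₀ + (b₀ + toColex (single n 1)), ?_, ?_⟩
    · gcongr
      apply lt_add_of_pos_right
      rw [lt_single_iff]
      exact fun _ _ => rfl
    · intro a' ha' b' hb'
      obtain ⟨r, hr, hle⟩ := add_single_le_of_lt hm ha'
      obtain ⟨s, hs, hle'⟩ := add_single_le_of_lt hn hb'
      have h1 : a' ≤ a₀ + r := by
        rw [← add_le_add_iff_right (toColex (single m 1))]
        exact hle.trans_eq (by abel)
      have h2 : b' ≤ b₀ + s := by
        rw [← add_le_add_iff_right (toColex (single n 1))]
        exact hle'.trans_eq (by abel)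
      calc a' + b' ≤ a₀ + r + (b₀ + s) := add_le_add h1 h2
        _ = a₀ + (b₀ + (r + s)) := by abel
        _ < _ := by
          gcongr
          exact add_lt_single (hr.trans_le (Colex.single_le_iff.2 hmn)) hs
  obtain ⟨m, ham, hm⟩ := exists_min_support ha
  obtain ⟨n, hbn, hn⟩ := exists_min_support hb
  rcases le_total m n with hmn | hmn
  · exact key m n hmn ham hbn hm hn
  · obtain ⟨t, ht, h⟩ := key n m hmn hbn ham hn hm
    exact ⟨t, by rwa [add_comm], fun a' ha' b' hb' => by rw [add_comm]; exact h b' hb' a' ha'⟩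

theorem exists_forall_lt {ι : Type} (f : ι → Colex (Ordinal.{0} →₀ ℕ)) : ∃ t, ∀ i, f i < t := by
  refine ⟨toColex (single (⨆ i, ⨆ k : (ofColex (f i)).support, Order.succ (k : Ordinal.{0})) 1),
    fun i => ?_⟩
  rw [lt_single_iff]
  intro k hk
  by_contra hne
  have h1 := Ordinal.le_iSup (fun k : (ofColex (f i)).support => Order.succ (k : Ordinal.{0}))
    ⟨k, mem_support_iff.2 hne⟩
  have h2 := Ordinal.le_iSup
    (fun i => ⨆ k : (ofColex (f i)).support, Order.succ (k : Ordinal.{0})) i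
  exact absurd ((h1.trans h2).trans hk) (not_le.2 (Order.lt_succ k))

end Finsupp.Colex

/-! ### One-sided neighbourhoods and coefficients of products. -/

theorem Real.eventually_nhdsLE_iff {a : ℝ} {p : ℝ → Prop} :
    (∀ᶠ x in 𝓝[≤] a, p x) ↔ ∃ l < a, ∀ x, l < x → x ≤ a → p x := by
  rw [Filter.Eventually, mem_nhdsLE_iff_exists_Ioc_subset]
  exact ⟨fun ⟨l, hl, h⟩ => ⟨l, hl, fun x h1 h2 => h ⟨h1, h2⟩⟩,
    fun ⟨l, hl, h⟩ => ⟨l, hl, fun x hx => h x hx.1 hx.2⟩⟩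

theorem Real.eventually_nhdsLT_iff {a : ℝ} {p : ℝ → Prop} :
    (∀ᶠ x in 𝓝[<] a, p x) ↔ ∃ l < a, ∀ x, l < x → x < a → p x := by
  rw [Filter.Eventually, mem_nhdsLT_iff_exists_Ioo_subset]
  exact ⟨fun ⟨l, hl, h⟩ => ⟨l, hl, fun x h1 h2 => h ⟨h1, h2⟩⟩,
    fun ⟨l, hl, h⟩ => ⟨l, hl, fun x hx => h x hx.1 hx.2⟩⟩

namespace HahnSeries

variable {K : Type*} [Field K]

theorem finite_support_coeff_mul_coeff_sub (x y : HahnSeries ℝ K) (a : ℝ) :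
    (Function.support fun u => x.coeff u * y.coeff (a - u)).Finite := by
  refine ((Set.AddAntidiagonal.finite_of_isPWO x.isPWO_support y.isPWO_support a).image
    Prod.fst).subset fun u hu => ⟨(u, a - u), ?_, rfl⟩
  exact ⟨left_ne_zero_of_mul hu, right_ne_zero_of_mul hu, add_sub_cancel _ _⟩

theorem coeff_mul_eq_finsum (x y : HahnSeries ℝ K) (a : ℝ) :
    (x * y).coeff a = ∑ᶠ u, x.coeff u * y.coeff (a - u) := by
  rw [coeff_mul, finsum_eq_sum_of_support_subset (s := (Finset.antidiagonal
    x.isPWO_support y.isPWO_support a).image Prod.fst), Finset.sum_image]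
  · refine Finset.sum_congr rfl fun ij hij => ?_
    rw [Finset.mem_antidiagonal] at hij
    rw [← hij.2.2, add_sub_cancel_left]
  · intro p hp q hq h
    rw [Finset.mem_coe, Finset.mem_antidiagonal] at hp hq
    exact Prod.ext h (by linarith [hp.2.2, hq.2.2])
  · intro u hu
    rw [Finset.mem_coe, Finset.mem_image]
    refine ⟨(u, a - u), ?_, rfl⟩
    rw [Finset.mem_antidiagonal]
    exact ⟨left_ne_zero_of_mul hu, right_ne_zero_of_mul hu, add_sub_cancel _ _⟩

end HahnSeries

/-! ### Germs and the convolution formula. -/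

namespace nonposSeries

variable {K : Type*} [Field K]

theorem coeff_eq_zero (b : nonposSeries K) {x : ℝ} (hx : 0 < x) :
    (b : HahnSeries ℝ K).coeff x = 0 := by
  by_contra h
  exact absurd (b.2 h) (not_le.2 hx)

/-- The truncation of a series at `g`, divided by `t ^ g`. -/
noncomputable def germ (g : ℝ) : nonposSeries K →+ nonposSeries K where
  toFun b :=
    ⟨{ coeff := fun x => if x ≤ 0 then (b : HahnSeries ℝ K).coeff (x + g) else 0
       isPWO_support' := by
        have h : ((fun x => x - g) '' (b : HahnSeries ℝ K).support).IsPWO :=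
          (b : HahnSeries ℝ K).isPWO_support.image_of_monotone
            fun _ _ h => sub_le_sub_right h g
        refine h.mono fun x hx => ⟨x + g, ?_, add_sub_cancel_right _ _⟩
        intro h0
        simp [h0] at hx },
      fun x hx => by
        by_contra h
        exact hx (if_neg h)⟩
  map_zero' := by
    ext x
    simp
  map_add' b c := by
    ext x
    by_cases h : x ≤ 0 <;> simp [h]

theorem coeff_germ (g : ℝ) (b : nonposSeries K) (x : ℝ) :
    (germ g b : HahnSeries ℝ K).coeff x =
      if x ≤ 0 then (b : HahnSeries ℝ K).coeff (x + g) else 0 := rfl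

theorem germ_zero (b : nonposSeries K) : germ 0 b = b := by
  ext x
  rw [coeff_germ, add_zero]
  split_ifs with h
  · rfl
  · rw [coeff_eq_zero b (not_le.1 h)]

theorem germ_germ {d : ℝ} (hd : d ≤ 0) (g : ℝ) (b : nonposSeries K) :
    germ d (germ g b) = germ (d + g) b := by
  ext x
  rw [coeff_germ, coeff_germ, coeff_germ]
  split_ifs with h1 h2
  · rw [add_assoc]
  · exact absurd (add_nonpos h1 hd) h2
  · rfl

variable (K) in
/-- The ideal of the series whose support has negative supremum. -/
def negligible : Ideal (nonposSeries K) where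
  carrier := {b | ∀ᶠ x in 𝓝[≤] (0 : ℝ), (b : HahnSeries ℝ K).coeff x = 0}
  zero_mem' := by simp
  add_mem' := by
    intro b c hb hc
    refine (Filter.Eventually.and (Set.mem_ofPred_eq ▸ hb) (Set.mem_ofPred_eq ▸ hc)).mono
      fun x hx => ?_
    simp [hx.1, hx.2]
  smul_mem' := by
    intro c b hb
    obtain ⟨l, hl, h⟩ := Real.eventually_nhdsLE_iff.1 hb
    refine Real.eventually_nhdsLE_iff.2 ⟨l, hl, fun x hx _ => ?_⟩
    by_contra hne
    obtain ⟨y, hy, z, hz, rfl⟩ := Set.mem_add.1 (HahnSeries.support_mul_subset hne)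
    have hy0 : y ≤ 0 := c.2 hy
    exact hz (h z (by linarith) (b.2 hz))

theorem mem_negligible {b : nonposSeries K} :
    b ∈ negligible K ↔ ∀ᶠ x in 𝓝[≤] (0 : ℝ), (b : HahnSeries ℝ K).coeff x = 0 := Iff.rfl

theorem germ_mem_negligible {g : ℝ} {b : nonposSeries K} :
    germ g b ∈ negligible K ↔
      ∃ l < g, ∀ x, l < x → x ≤ g → (b : HahnSeries ℝ K).coeff x = 0 := by
  rw [mem_negligible, Real.eventually_nhdsLE_iff]
  constructor
  · rintro ⟨l, hl, h⟩
    refine ⟨l + g, by linarith, fun x h1 h2 => ?_⟩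
    have := h (x - g) (by linarith) (by linarith)
    rwa [coeff_germ, if_pos (by linarith), sub_add_cancel] at this
  · rintro ⟨l, hl, h⟩
    refine ⟨l - g, by linarith, fun x h1 h2 => ?_⟩
    rw [coeff_germ, if_pos h2, h _ (by linarith) (by linarith)]

theorem germ_notMem_negligible {g : ℝ} {b : nonposSeries K} :
    germ g b ∉ negligible K ↔
      ∀ l < g, ∃ x, l < x ∧ x ≤ g ∧ (b : HahnSeries ℝ K).coeff x ≠ 0 := by
  rw [germ_mem_negligible]
  push Not
  rfl

theorem germ_mem_negligible_of_pos {g : ℝ} (hg : 0 < g) (b : nonposSeries K) :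
    germ g b ∈ negligible K :=
  germ_mem_negligible.2 ⟨0, hg, fun _ hx _ => coeff_eq_zero b hx⟩

/-- Such g are the limits from the left, or elements, of the support; a descending sequence of them
would interleave with one in the support. -/
theorem isPWO_setOf_germ_notMem (b : nonposSeries K) :
    {g | germ g b ∉ negligible K}.IsPWO := by
  rw [Set.isPWO_iff_isWF, Set.isWF_iff_no_descending_seq]
  intro f hf hmem
  have h : ∀ n, ∃ x, f (n + 1) < x ∧ x ≤ f n ∧ (b : HahnSeries ℝ K).coeff x ≠ 0 :=
    fun n => germ_notMem_negligible.1 (hmem n) _ (hf n.lt_succ_self)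
  choose x h1 h2 h3 using h
  have hx : StrictAnti x := strictAnti_nat_of_succ_lt fun n => (h2 (n + 1)).trans_lt (h1 n)
  exact Set.isWF_iff_no_descending_seq.1 (b : HahnSeries ℝ K).isWF_support x hx h3

theorem finite_setOf_germ_notMem (g : ℝ) (b c : nonposSeries K) :
    {u | germ u b ∉ negligible K ∧ germ (g - u) c ∉ negligible K}.Finite := by
  refine ((Set.AddAntidiagonal.finite_of_isPWO (isPWO_setOf_germ_notMem b)
    (isPWO_setOf_germ_notMem c) g).image Prod.fst).subset fun u hu => ⟨(u, g - u), ?_, rfl⟩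
  exact ⟨hu.1, hu.2, add_sub_cancel _ _⟩

/-- Compactness: counterexamples with z tending to g have a subsequence along which both exponents
increase; their limits u and g - u are then a pair of the required kind. -/
theorem eventually_forall_exists_germ_notMem (g : ℝ) (b c : nonposSeries K) :
    ∀ᶠ z in 𝓝[≤] g, ∀ x, (b : HahnSeries ℝ K).coeff x ≠ 0 →
      (c : HahnSeries ℝ K).coeff (z - x) ≠ 0 →
      ∃ u, germ u b ∉ negligible K ∧ germ (g - u) c ∉ negligible K ∧ x ≤ u ∧ z - x ≤ g - u := by
  rw [Real.eventually_nhdsLE_iff]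
  by_contra! hcon
  have h := fun n : ℕ => hcon (g - 1 / ((n : ℝ) + 1))
    (sub_lt_self _ (Nat.one_div_pos_of_nat (α := ℝ)))
  choose z hz1 hz2 x hb hc hu using h
  obtain ⟨φ, hφ⟩ := (b : HahnSeries ℝ K).isPWO_support.exists_monotone_subseq hb
  obtain ⟨ψ, hψ⟩ := (c : HahnSeries ℝ K).isPWO_support.exists_monotone_subseq
    (f := fun n => z (φ n) - x (φ n)) fun n => hc (φ n)
  have hX : Monotone fun n => x (φ (ψ n)) := fun m n hmn => hφ (ψ.monotone hmn)
  have hY : Monotone fun n => z (φ (ψ n)) - x (φ (ψ n)) := hψ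
  have hXb : BddAbove (Set.range fun n => x (φ (ψ n))) :=
    ⟨0, by rintro _ ⟨n, rfl⟩; exact b.2 (hb _)⟩
  have hYb : BddAbove (Set.range fun n => z (φ (ψ n)) - x (φ (ψ n))) :=
    ⟨0, by rintro _ ⟨n, rfl⟩; exact c.2 (hc _)⟩
  have hXt := tendsto_atTop_ciSup hX hXb
  have hYt := tendsto_atTop_ciSup hY hYb
  set u := ⨆ n, x (φ (ψ n)) with hu_def
  set v := ⨆ n, (z (φ (ψ n)) - x (φ (ψ n))) with hv_def
  have hzt : Tendsto z atTop (𝓝 g) := by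
    refine tendsto_of_tendsto_of_tendsto_of_le_of_le (g := fun n : ℕ => g - 1 / ((n : ℝ) + 1))
      (h := fun _ => g) ?_ tendsto_const_nhds (fun n => (hz1 n).le) hz2
    simpa using tendsto_const_nhds.sub (tendsto_one_div_add_atTop_nhds_zero_nat (𝕜 := ℝ))
  have huv : u + v = g := by
    refine tendsto_nhds_unique (hXt.add hYt) ?_
    refine (hzt.comp (φ.strictMono.comp ψ.strictMono).tendsto_atTop).congr fun n => ?_
    simp
  have hguv : g - u = v := by linarith
  refine absurd (hu (φ (ψ 0)) u ?_ ?_ (le_ciSup hXb 0)) (not_lt.2 ?_)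
  · rw [germ_notMem_negligible]
    intro l hl
    obtain ⟨n, hn⟩ := exists_lt_of_lt_ciSup hl
    exact ⟨_, hn, le_ciSup hXb n, hb _⟩
  · rw [germ_notMem_negligible, hguv]
    intro l hl
    obtain ⟨n, hn⟩ := exists_lt_of_lt_ciSup hl
    exact ⟨_, hn, le_ciSup hYb n, hc _⟩
  · rw [hguv]
    exact le_ciSup hYb 0

theorem coeff_germ_mul_germ (g u : ℝ) (b c : nonposSeries K) (x : ℝ) :
    ((germ u b * germ (g - u) c : nonposSeries K) : HahnSeries ℝ K).coeff x =
      ∑ᶠ v, if v ≤ u ∧ x + g - v ≤ g - u then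
        (b : HahnSeries ℝ K).coeff v * (c : HahnSeries ℝ K).coeff (x + g - v) else 0 := by
  rw [Subring.coe_mul, HahnSeries.coeff_mul_eq_finsum, ← finsum_comp_equiv (Equiv.subRight u)]
  refine finsum_congr fun v => ?_
  have e : x - (v - u) ≤ 0 ↔ x + g - v ≤ g - u := by constructor <;> intro <;> linarith
  rw [coeff_germ, coeff_germ, Equiv.subRight_apply, sub_add_cancel,
    show x - (v - u) + (g - u) = x + g - v by ring]
  by_cases h1 : v ≤ u <;> by_cases h2 : x + g - v ≤ g - u <;> simp [h1, h2, e]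

theorem germ_mul_sub_sum_mem (g : ℝ) (b c : nonposSeries K) (S : Finset ℝ)
    (hS : ∀ u, germ u b ∉ negligible K → germ (g - u) c ∉ negligible K → u ∈ S) :
    germ g (b * c) - ∑ u ∈ S, germ u b * germ (g - u) c ∈ negligible K := by
  have h1 := eventually_forall_exists_germ_notMem g b c
  have h2 : ∀ᶠ z in 𝓝[≤] g, ∀ u ∈ S, ∀ v ∈ S, u ≠ v → g - z < |u - v| := by
    simp only [Filter.eventually_all_finset, eventually_imp_distrib_left]
    intro u _ v _ huv
    have hpos : 0 < |u - v| := abs_pos.2 (sub_ne_zero.2 huv)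
    exact Real.eventually_nhdsLE_iff.2 ⟨g - |u - v|, by linarith, fun x _ _ => by linarith⟩
  obtain ⟨l, hl, h⟩ := Real.eventually_nhdsLE_iff.1 (h1.and h2)
  refine Real.eventually_nhdsLE_iff.2 ⟨l - g, by linarith, fun x hx hx0 => ?_⟩
  obtain ⟨h1, h2⟩ := h (x + g) (by linarith) (by linarith)
  have hfin := HahnSeries.finite_support_coeff_mul_coeff_sub
    (b : HahnSeries ℝ K) (c : HahnSeries ℝ K) (x + g)
  have hsum : ((∑ u ∈ S, germ u b * germ (g - u) c : nonposSeries K) : HahnSeries ℝ K).coeff x =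
      ∑ u ∈ S, ((germ u b * germ (g - u) c : nonposSeries K) : HahnSeries ℝ K).coeff x := by
    rw [AddSubmonoidClass.coe_finsetSum, HahnSeries.coeff_sum]
  rw [AddSubgroupClass.coe_sub, HahnSeries.coeff_sub, hsum, coeff_germ, if_pos hx0, Subring.coe_mul,
    HahnSeries.coeff_mul_eq_finsum, sub_eq_zero]
  simp_rw [coeff_germ_mul_germ]
  rw [← finsum_sum_comm]
  · refine finsum_congr fun v => ?_
    by_cases hv : (b : HahnSeries ℝ K).coeff v * (c : HahnSeries ℝ K).coeff (x + g - v) = 0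
    · simp [hv]
    · obtain ⟨u, hub, huc, hvu, hzu⟩ :=
        h1 v (left_ne_zero_of_mul hv) (right_ne_zero_of_mul hv)
      have huS := hS u hub huc
      -- Each term of the product is counted once: two indices that both cover v differ by at most g
      -- - z, with z = x + g, which the separation of S forbids.
      rw [Finset.sum_eq_single u, if_pos ⟨hvu, hzu⟩]
      · intro w hw hwu
        rw [if_neg]
        rintro ⟨hvw, hzw⟩
        refine absurd (h2 w hw u huS hwu) (not_lt.2 ?_)
        rw [abs_le]
        constructor <;> linarith
      · exact fun hu => absurd huS hu
  · intro u _
    refine hfin.subset fun v hv hv0 => hv ?_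
    simp only [hv0, ite_self]

theorem germ_mul {g : ℝ} (hg : g < 0) (b c : nonposSeries K) :
    ∃ S : Finset ℝ, (∀ u ∈ S, g < u ∧ u < 0) ∧
      germ g (b * c) - (b * germ g c + germ g b * c + ∑ u ∈ S, germ u b * germ (g - u) c) ∈
        negligible K := by
  classical
  set F := (finite_setOf_germ_notMem g b c).toFinset
  set S := F.filter fun u => g < u ∧ u < 0
  refine ⟨S, fun u hu => (Finset.mem_filter.1 hu).2, ?_⟩
  -- The extreme indices 0 and g give the two Leibniz terms; extra indices do no harm.
  have h := germ_mul_sub_sum_mem g b c (insert 0 (insert g S)) ?_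
  · rw [Finset.sum_insert, Finset.sum_insert, germ_zero, sub_zero, sub_self, germ_zero,
      ← add_assoc] at h
    · exact h
    · simp [S]
    · simp [S, hg.ne']
  · intro u hub huc
    have hu0 : u ≤ 0 := by
      by_contra hu
      exact hub (germ_mem_negligible_of_pos (not_le.1 hu) b)
    have hgu : g ≤ u := by
      by_contra hu
      exact huc (germ_mem_negligible_of_pos (sub_pos.2 (not_le.1 hu)) c)
    simp only [Finset.mem_insert]
    rcases hu0.eq_or_lt with rfl | hu0
    · exact Or.inl rfl
    rcases hgu.eq_or_lt with rfl | hgu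
    · exact Or.inr (Or.inl rfl)
    · refine Or.inr (Or.inr (Finset.mem_filter.2 ⟨?_, hgu, hu0⟩))
      exact (Set.Finite.mem_toFinset _).2 ⟨hub, huc⟩

theorem germ_mem_negligible_of_mem {b : nonposSeries K} (hb : b ∈ negligible K) :
    ∀ᶠ g in 𝓝[<] (0 : ℝ), germ g b ∈ negligible K := by
  obtain ⟨l, hl, h⟩ := Real.eventually_nhdsLE_iff.1 (mem_negligible.1 hb)
  exact Real.eventually_nhdsLT_iff.2 ⟨l, hl, fun g hg hg0 =>
    germ_mem_negligible.2 ⟨l, hg, fun x h1 h2 => h x h1 (h2.trans hg0.le)⟩⟩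

/-! ### Rank and its subadditivity under products. -/

/-- The ranks of series: ordinals in Cantor normal form, with their natural sum. -/
abbrev RankType : Type 1 := Colex (Ordinal.{0} →₀ ℕ)

/-- The Cantor–Bendixson rank at `0` of the support of `b`, up to negligible series, is at
most `a`. -/
def RankLE (a : RankType) (b : nonposSeries K) : Prop :=
  ∀ᶠ g in 𝓝[<] (0 : ℝ), germ g b ∈ negligible K ∨
    ∃ a' : RankType, ∃ _ : a' < a, RankLE a' (germ g b)
termination_by (wellFounded_lt (α := RankType)).wrap a
decreasing_by assumption

/-- `b` is negligible or has rank less than `a`. -/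
def RankLT (a : RankType) (b : nonposSeries K) : Prop :=
  b ∈ negligible K ∨ ∃ a' < a, RankLE a' b

theorem rankLE_iff {a : RankType} {b : nonposSeries K} :
    RankLE a b ↔ ∀ᶠ g in 𝓝[<] (0 : ℝ), RankLT a (germ g b) := by
  rw [RankLE]
  simp only [RankLT, exists_prop]

theorem RankLT.mono {a a' : RankType} {b : nonposSeries K} (h : RankLT a b) (haa : a ≤ a') :
    RankLT a' b :=
  h.imp_right fun ⟨t, ht, hb⟩ => ⟨t, ht.trans_le haa, hb⟩

theorem RankLE.mono {a a' : RankType} {b : nonposSeries K} (h : RankLE a b) (haa : a ≤ a') :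
    RankLE a' b :=
  rankLE_iff.2 ((rankLE_iff.1 h).mono fun _ hg => hg.mono haa)

theorem RankLE.rankLT {a a' : RankType} {b : nonposSeries K} (h : RankLE a b) (haa : a < a') :
    RankLT a' b :=
  Or.inr ⟨a, haa, h⟩

theorem rankLE_of_mem {b : nonposSeries K} (hb : b ∈ negligible K) (a : RankType) :
    RankLE a b :=
  rankLE_iff.2 ((germ_mem_negligible_of_mem hb).mono fun _ hg => Or.inl hg)

theorem RankLT.rankLE {a : RankType} {b : nonposSeries K} (h : RankLT a b) : RankLE a b := by
  rcases h with h | ⟨a', ha', h⟩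
  · exact rankLE_of_mem h a
  · exact h.mono ha'.le

theorem RankLE.add {a : RankType} {b c : nonposSeries K} (hb : RankLE a b) (hc : RankLE a c) :
    RankLE a (b + c) := by
  induction a using WellFoundedLT.induction generalizing b c with
  | ind a ih =>
    rw [rankLE_iff] at *
    filter_upwards [hb, hc] with g hgb hgc
    rw [map_add]
    rcases hgb with hgb | ⟨s, hs, hgb⟩
    · rcases hgc with hgc | ⟨t, ht, hgc⟩
      · exact Or.inl (add_mem hgb hgc)
      · exact Or.inr ⟨t, ht, ih t ht (rankLE_of_mem hgb t) hgc⟩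
    · rcases hgc with hgc | ⟨t, ht, hgc⟩
      · exact Or.inr ⟨s, hs, ih s hs hgb (rankLE_of_mem hgc s)⟩
      · exact Or.inr ⟨max s t, max_lt hs ht, ih _ (max_lt hs ht)
          (hgb.mono (le_max_left s t)) (hgc.mono (le_max_right s t))⟩

theorem RankLT.add {a : RankType} {b c : nonposSeries K} (hb : RankLT a b) (hc : RankLT a c) :
    RankLT a (b + c) := by
  rcases hb with hb | ⟨s, hs, hb⟩
  · rcases hc with hc | ⟨t, ht, hc⟩
    · exact Or.inl (add_mem hb hc)
    · exact Or.inr ⟨t, ht, (rankLE_of_mem hb t).add hc⟩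
  · rcases hc with hc | ⟨t, ht, hc⟩
    · exact Or.inr ⟨s, hs, hb.add (rankLE_of_mem hc s)⟩
    · exact Or.inr ⟨max s t, max_lt hs ht,
        (hb.mono (le_max_left s t)).add (hc.mono (le_max_right s t))⟩

theorem RankLT.sum {a : RankType} {S : Finset ℝ} {f : ℝ → nonposSeries K}
    (h : ∀ u ∈ S, RankLT a (f u)) : RankLT a (∑ u ∈ S, f u) :=
  Finset.sum_induction f (RankLT a) (fun _ _ => RankLT.add) (Or.inl (zero_mem _)) h

theorem RankLE.mul {a a' : RankType} {b c : nonposSeries K} (hb : RankLE a b)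
    (hc : RankLE a' c) : RankLE (a + a') (b * c) := by
  obtain ⟨s, hs⟩ : ∃ s, s = a + a' := ⟨_, rfl⟩
  induction s using WellFoundedLT.induction generalizing a a' b c with
  | ind s ih =>
    subst hs
    have lt_right : ∀ {t t' : RankType} {x y : nonposSeries K}, t ≤ a → t' ≤ a' →
        RankLE t x → RankLT t' y → RankLT (a + a') (x * y) := by
      rintro t t' x y hta hta' hx (hy | ⟨r, hr, hy⟩)
      · exact Or.inl (Ideal.mul_mem_left _ _ hy)
      · have hlt : t + r < a + a' := add_lt_add_of_le_of_lt hta (hr.trans_le hta')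
        exact (ih _ hlt hx hy rfl).rankLT hlt
    obtain ⟨l, hl, hb'⟩ := Real.eventually_nhdsLT_iff.1 (rankLE_iff.1 hb)
    obtain ⟨l', hl', hc'⟩ := Real.eventually_nhdsLT_iff.1 (rankLE_iff.1 hc)
    refine rankLE_iff.2 (Real.eventually_nhdsLT_iff.2 ⟨max l l', max_lt hl hl', fun g hg hg0 => ?_⟩)
    rw [max_lt_iff] at hg
    obtain ⟨S, hS, h⟩ := germ_mul hg0 b c
    rw [← sub_add_cancel (germ g (b * c)) (b * germ g c + germ g b * c +
      ∑ u ∈ S, germ u b * germ (g - u) c)]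
    refine RankLT.add (Or.inl h) (RankLT.add (RankLT.add ?_ ?_) (RankLT.sum fun u hu => ?_))
    · exact lt_right le_rfl le_rfl hb (hc' g hg.2 hg0)
    · rcases hb' g hg.1 hg0 with hgb | ⟨r, hr, hgb⟩
      · exact Or.inl (Ideal.mul_mem_right _ _ hgb)
      · have hlt : r + a' < a + a' := by gcongr
        exact (ih _ hlt hgb hc rfl).rankLT hlt
    · obtain ⟨hgu, hu0⟩ := hS u hu
      exact lt_right le_rfl le_rfl (hb' u (hg.1.trans hgu) hu0).rankLE
        (hc' (g - u) (by linarith) (by linarith))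

theorem RankLE.mul_rankLT {a a' : RankType} {b c : nonposSeries K} (hb : RankLE a b)
    (hc : RankLT a' c) : RankLT (a + a') (b * c) := by
  rcases hc with hc | ⟨r, hr, hc⟩
  · exact Or.inl (Ideal.mul_mem_left _ _ hc)
  · exact (hb.mul hc).rankLT (by gcongr)

theorem RankLT.mul_rankLE {a a' : RankType} {b c : nonposSeries K} (hb : RankLT a b)
    (hc : RankLE a' c) : RankLT (a + a') (b * c) := by
  rw [mul_comm, add_comm]
  exact hc.mul_rankLT hb

theorem RankLT.mul_lt {a a' t : RankType} (ht : ∀ r < a, ∀ s < a', r + s < t)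
    {b c : nonposSeries K} (hb : RankLT a b) (hc : RankLT a' c) : RankLT t (b * c) := by
  rcases hb with hb | ⟨r, hr, hb⟩
  · exact Or.inl (Ideal.mul_mem_right _ _ hb)
  rcases hc with hc | ⟨s, hs, hc⟩
  · exact Or.inl (Ideal.mul_mem_left _ _ hc)
  exact (hb.mul hc).rankLT (ht r hr s hs)

/-! ### Constants and existence of the rank. -/

variable (K) in
/-- The constant series. -/
noncomputable def const : K →+* nonposSeries K :=
  (HahnSeries.C : K →+* HahnSeries ℝ K).codRestrict (nonposSeries K) fun k x hx => by
    have : x = 0 := by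
      by_contra h
      exact hx (by rw [HahnSeries.C_apply, HahnSeries.coeff_single_of_ne h])
    exact this.le

theorem coeff_const (k : K) (x : ℝ) :
    (const K k : HahnSeries ℝ K).coeff x = if x = 0 then k else 0 := by
  change (HahnSeries.C k : HahnSeries ℝ K).coeff x = _
  rw [HahnSeries.C_apply, HahnSeries.coeff_single]

theorem rankLE_zero_const (k : K) : RankLE 0 (const K k) := by
  refine rankLE_iff.2 (Real.eventually_nhdsLT_iff.2 ⟨-1, by norm_num, fun g _ hg0 => Or.inl ?_⟩)
  refine germ_mem_negligible.2 ⟨g - 1, by linarith, fun x _ hx => ?_⟩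
  rw [coeff_const, if_neg (hx.trans_lt hg0).ne]

theorem RankLT.const_mul {a : RankType} {b : nonposSeries K} (hb : RankLT a b) (k : K) :
    RankLT a (const K k * b) := by
  simpa using (rankLE_zero_const k).mul_rankLT hb

theorem RankLT.neg {a : RankType} {b : nonposSeries K} (hb : RankLT a b) : RankLT a (-b) := by
  simpa using hb.const_mul (-1)

theorem RankLT.sub {a : RankType} {b c : nonposSeries K} (hb : RankLT a b) (hc : RankLT a c) :
    RankLT a (b - c) := by
  rw [sub_eq_add_neg]
  exact hb.add hc.neg

theorem RankLE.one : RankLE 0 (1 : nonposSeries K) := by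
  simpa using rankLE_zero_const (1 : K)

theorem RankLE.pow {a : RankType} {b : nonposSeries K} (hb : RankLE a b) (n : ℕ) :
    RankLE (n • a) (b ^ n) := by
  induction n with
  | zero => simpa using RankLE.one
  | succ n ih =>
    rw [succ_nsmul, pow_succ]
    exact ih.mul hb

theorem RankLT.of_natCast_mul [CharZero K] {a : RankType} {b : nonposSeries K} {n : ℕ}
    (hn : n ≠ 0) (h : RankLT a ((n : nonposSeries K) * b)) : RankLT a b := by
  have := h.const_mul (n : K)⁻¹
  rwa [← map_natCast (const K) n, ← mul_assoc, ← map_mul,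
    inv_mul_cancel₀ (Nat.cast_ne_zero.2 hn), map_one, one_mul] at this

/-- At a least g whose germ has no rank, all earlier germs have one, and these ranks, indexed by a
small type, have a common strict bound. -/
theorem exists_rankLE (b : nonposSeries K) : ∃ a, RankLE a b := by
  by_contra hb
  set U := {g : ℝ | ¬∃ a, RankLE a (germ g b)} with hU
  have hsub : U ⊆ {g | germ g b ∉ negligible K} :=
    fun g hg hmem => hg ⟨0, rankLE_of_mem hmem 0⟩
  have hwf : U.IsWF := ((isPWO_setOf_germ_notMem b).mono hsub).isWF
  have hne : U.Nonempty := ⟨0, by rwa [hU, Set.mem_ofPred_eq, germ_zero]⟩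
  refine hwf.min_mem hne ?_
  have h : ∀ d : Set.Iio (0 : ℝ), ∃ a, RankLE a (germ d (germ (hwf.min hne) b)) := by
    intro d
    rw [germ_germ (le_of_lt d.2)]
    by_contra hcon
    exact hwf.not_lt_min hne hcon (add_lt_of_neg_left _ d.2)
  choose f hf using h
  obtain ⟨t, ht⟩ := Finsupp.Colex.exists_forall_lt f
  exact ⟨t, rankLE_iff.2 (Real.eventually_nhdsLT_iff.2 ⟨-1, by norm_num, fun g _ hg0 =>
    (hf ⟨g, hg0⟩).rankLT (ht ⟨g, hg0⟩)⟩)⟩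

/-- `b` is not negligible and its rank is exactly `a`. -/
def HasRank (b : nonposSeries K) (a : RankType) : Prop :=
  RankLE a b ∧ ¬RankLT a b

theorem HasRank.notMem {b : nonposSeries K} {a : RankType} (h : HasRank b a) :
    b ∉ negligible K :=
  fun hb => h.2 (Or.inl hb)

theorem HasRank.lt {b : nonposSeries K} {a t : RankType} (h : HasRank b a) (ht : RankLT t b) :
    a < t := by
  by_contra hcon
  exact h.2 (ht.mono (not_lt.1 hcon))

theorem HasRank.le {b : nonposSeries K} {a t : RankType} (h : HasRank b a) (ht : RankLE t b) :
    a ≤ t := by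
  by_contra hcon
  exact h.2 (ht.rankLT (not_le.1 hcon))

theorem RankLE.exists_hasRank_le {b : nonposSeries K} {t : RankType} (h : RankLE t b)
    (hb : b ∉ negligible K) : ∃ a ≤ t, HasRank b a := by
  induction t using WellFoundedLT.induction with
  | ind t ih =>
    by_cases hlt : RankLT t b
    · rcases hlt with hlt | ⟨s, hs, hlt⟩
      · exact absurd hlt hb
      · obtain ⟨a, ha, hab⟩ := ih s hs hlt
        exact ⟨a, ha.trans hs.le, hab⟩
    · exact ⟨t, le_rfl, h, hlt⟩

theorem exists_hasRank {b : nonposSeries K} (hb : b ∉ negligible K) : ∃ a, HasRank b a := by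
  obtain ⟨t, ht⟩ := exists_rankLE b
  obtain ⟨a, -, h⟩ := ht.exists_hasRank_le hb
  exact ⟨a, h⟩

/-! ### Leibniz rule and additivity of the rank. -/

theorem HasRank.frequently {b : nonposSeries K} {a a' : RankType} (h : HasRank b a)
    (ha : a' < a) : ∃ᶠ g in 𝓝[<] (0 : ℝ), ∃ r, a' ≤ r ∧ r < a ∧ HasRank (germ g b) r := by
  have h1 : ∃ᶠ g in 𝓝[<] (0 : ℝ), ¬RankLT a' (germ g b) := by
    intro hcon
    exact absurd (h.le (rankLE_iff.2 (hcon.mono fun _ => not_not.1))) (not_le.2 ha)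
  refine (h1.and_eventually (rankLE_iff.1 h.1)).mono fun g hg => ?_
  obtain ⟨r, -, hr⟩ := hg.2.rankLE.exists_hasRank_le fun hmem => hg.1 (Or.inl hmem)
  refine ⟨r, ?_, hr.lt hg.2, hr⟩
  by_contra hcon
  exact hg.1 (hr.1.rankLT (not_le.1 hcon))

/-- In the interior terms of the convolution both factors have dropped in rank, so a single t below
a + a' bounds them for all g near 0. -/
theorem RankLE.germ_mul_sub {a a' : RankType} (ha : a ≠ 0) {b c : nonposSeries K}
    (hb : RankLE a b) (hc : RankLE a' c) :
    ∃ t < a + a', ∀ᶠ g in 𝓝[<] (0 : ℝ),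
      RankLT t (germ g (b * c) - (b * germ g c + germ g b * c)) := by
  obtain ⟨t, ht, htlt⟩ := Finsupp.Colex.exists_lt_add_forall_add_lt ha a'
  refine ⟨t, ht, ?_⟩
  obtain ⟨l, hl, hb'⟩ := Real.eventually_nhdsLT_iff.1 (rankLE_iff.1 hb)
  obtain ⟨l', hl', hc'⟩ := Real.eventually_nhdsLT_iff.1 (rankLE_iff.1 hc)
  refine Real.eventually_nhdsLT_iff.2 ⟨max l l', max_lt hl hl', fun g hg hg0 => ?_⟩
  rw [max_lt_iff] at hg
  obtain ⟨S, hS, h⟩ := germ_mul hg0 b c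
  have hsum : RankLT t (∑ u ∈ S, germ u b * germ (g - u) c) := RankLT.sum fun u hu => by
    obtain ⟨hgu, hu0⟩ := hS u hu
    exact RankLT.mul_lt htlt (hb' u (hg.1.trans hgu) hu0) (hc' (g - u) (by linarith) (by linarith))
  convert RankLT.add (Or.inl h) hsum using 1
  abel

theorem RankLE.germ_pow_mul_sub {a a' : RankType} (ha : a ≠ 0) {b c : nonposSeries K}
    (hb : RankLE a b) (hc : RankLE a' c) (n : ℕ) :
    ∃ t < (n + 1) • a + a', ∀ᶠ g in 𝓝[<] (0 : ℝ),
      RankLT t (germ g (b ^ (n + 1) * c) - (b ^ (n + 1) * germ g c +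
        ((n + 1 : ℕ) : nonposSeries K) * (germ g b * (b ^ n * c)))) := by
  induction n with
  | zero => simpa using hb.germ_mul_sub ha hc
  | succ n ih =>
    obtain ⟨t, ht, h⟩ := ih
    obtain ⟨s, hs, h'⟩ := hb.germ_mul_sub ha ((hb.pow (n + 1)).mul hc)
    have e : (n + 1 + 1) • a + a' = a + ((n + 1) • a + a') := by rw [succ_nsmul', add_assoc]
    refine ⟨max s (a + t), ?_, ?_⟩
    · rw [e]
      exact max_lt hs (by gcongr)
    · filter_upwards [h, h'] with g hg hg'
      have := (hg'.mono (le_max_left s (a + t))).add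
        ((hb.mul_rankLT hg).mono (le_max_right s (a + t)))
      convert this using 1
      rw [show b ^ (n + 1 + 1) * c = b * (b ^ (n + 1) * c) by ring]
      push_cast
      ring

/-- Rank 0 means that the support has no points in some interval (l, 0), so only the constant
coefficient survives. -/
theorem HasRank.exists_sub_const_mem {b : nonposSeries K} (hb : HasRank b 0) :
    ∃ k ≠ 0, b - const K k ∈ negligible K := by
  have hmem : b - const K ((b : HahnSeries ℝ K).coeff 0) ∈ negligible K := by
    obtain ⟨l, hl, h⟩ := Real.eventually_nhdsLT_iff.1 (rankLE_iff.1 hb.1)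
    refine Real.eventually_nhdsLE_iff.2 ⟨l, hl, fun x hx hx0 => ?_⟩
    rw [AddSubgroupClass.coe_sub, HahnSeries.coeff_sub, coeff_const]
    rcases hx0.eq_or_lt with rfl | hx0
    · simp
    · rcases h x hx hx0 with hg | ⟨s, hs, -⟩
      · obtain ⟨m, hm, hz⟩ := germ_mem_negligible.1 hg
        rw [hz x hm le_rfl, if_neg hx0.ne, sub_zero]
      · exact absurd hs not_lt_zero
  refine ⟨_, fun h0 => hb.notMem ?_, hmem⟩
  simpa [h0] using hmem

theorem HasRank.mul_of_zero {b c : nonposSeries K} {a : RankType} (hb : HasRank b 0)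
    (hc : HasRank c a) : HasRank (b * c) a := by
  refine ⟨by simpa using hb.1.mul hc.1, fun h => hc.2 ?_⟩
  obtain ⟨k, hk, hmem⟩ := hb.exists_sub_const_mem
  have h1 : RankLT a (const K k * c) := by
    have h2 : RankLT a ((b - const K k) * c) := Or.inl (Ideal.mul_mem_right _ _ hmem)
    convert h.sub h2 using 1
    ring
  have := h1.const_mul k⁻¹
  rwa [← mul_assoc, ← map_mul, inv_mul_cancel₀ hk, map_one, one_mul] at this

/-- The step of the induction for the multiplicativity of the rank. -/
theorem HasRank.pow_succ_mul [CharZero K] {a a' : RankType} (ha : a ≠ 0) {b c : nonposSeries K}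
    (hb : HasRank b a) (hc : HasRank c a') {n : ℕ} (hn : HasRank (b ^ n * c) (n • a + a'))
    (ih : ∀ r < a, ∀ {x : nonposSeries K}, HasRank x r → ∀ {y : nonposSeries K} {s : RankType},
      HasRank y s → HasRank (x * y) (r + s))
    (ih' : ∀ r < a', ∀ {x : nonposSeries K}, HasRank x r → ∀ m : ℕ,
      HasRank (b ^ m * x) (m • a + r)) :
    HasRank (b ^ (n + 1) * c) ((n + 1) • a + a') := by
  refine ⟨(hb.1.pow _).mul hc.1, fun hlt => ?_⟩
  obtain ⟨τ, hτ, hp⟩ : ∃ τ < (n + 1) • a + a', RankLE τ (b ^ (n + 1) * c) := by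
    rcases hlt with hmem | h
    · refine ⟨0, ?_, rankLE_of_mem hmem 0⟩
      rw [succ_nsmul', add_assoc]
      exact add_pos_of_pos_of_nonneg (pos_iff_ne_zero.2 ha) (not_lt.1 not_lt_zero)
    · exact h
  obtain ⟨θ, hθ, hlow⟩ := hb.1.germ_pow_mul_sub ha hc.1 n
  obtain ⟨t, ht⟩ : ∃ t, t = max τ θ := ⟨_, rfl⟩
  have hta : t < (n + 1) • a + a' := ht ▸ max_lt hτ hθ
  replace hp : RankLE t (b ^ (n + 1) * c) := hp.mono (ht ▸ le_max_left τ θ)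
  have hs : ∀ᶠ g in 𝓝[<] (0 : ℝ), RankLT t (b ^ (n + 1) * germ g c +
      ((n + 1 : ℕ) : nonposSeries K) * (germ g b * (b ^ n * c))) := by
    filter_upwards [hlow, rankLE_iff.1 hp] with g h1 h2
    convert h2.sub (h1.mono (ht ▸ le_max_right τ θ)) using 1
    ring
  -- Since t is below (n+1)a + a', it is bounded after lowering either a' or one copy of a.
  by_cases hcase : ∃ s < a', t ≤ (n + 1) • a + s
  · obtain ⟨s, hs', hts⟩ := hcase
    obtain ⟨g, ⟨r, hsr, hra, hgr⟩, hg, hgb⟩ :=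
      ((hc.frequently hs').and_eventually (hs.and (rankLE_iff.1 hb.1))).exists
    -- Multiplying by b turns the second summand into a multiple of germ(b) b^(n+1) c, of rank below
    -- a + t by the assumed drop; this isolates b^(n+2) germ(c).
    have h1 := hb.1.mul_rankLT hg
    have h2 : RankLT (a + t) (((n + 1 : ℕ) : nonposSeries K) * (germ g b * (b ^ (n + 1) * c))) := by
      rw [← map_natCast (const K)]
      exact (hgb.mul_rankLE hp).const_mul _
    have h3 : RankLT (a + t) (b ^ (n + 1 + 1) * germ g c) := by
      convert h1.sub h2 using 1
      ring
    refine absurd ((ih' r hra hgr (n + 1 + 1)).lt h3) (not_lt.2 ?_)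
    rw [succ_nsmul' a (n + 1), add_assoc]
    gcongr
    exact hts.trans (by gcongr)
  · rcases Finsupp.Colex.exists_le_nsmul_add_of_lt hta with ⟨s, hsa, k, hk, hts⟩ | hcon
    · obtain rfl : n = k := by omega
      obtain ⟨g, ⟨r, hsr, hra, hgr⟩, hg, hgc⟩ :=
        ((hb.frequently hsa).and_eventually (hs.and (rankLE_iff.1 hc.1))).exists
      -- As no s < a' reaches t, this summand already lies below t, which isolates germ(b) b^n c.
      have h1 : RankLT t (b ^ (n + 1) * germ g c) := by
        rcases hgc with hgc | ⟨r', hr', hgc⟩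
        · exact Or.inl (Ideal.mul_mem_left _ _ hgc)
        · exact ((hb.1.pow (n + 1)).mul hgc).rankLT
            (not_le.1 fun hle => hcase ⟨r', hr', hle⟩)
      have h2 : RankLT t (germ g b * (b ^ n * c)) := by
        refine RankLT.of_natCast_mul n.succ_ne_zero ?_
        convert hg.sub h1 using 1
        ring
      exact absurd ((ih r hra hgr hn).lt h2) (not_lt.2 (hts.trans (by gcongr)))
    · exact hcase hcon

/-- The rank is multiplicative with respect to the natural sum. -/
theorem HasRank.mul [CharZero K] {a a' : RankType} {b c : nonposSeries K} (hb : HasRank b a)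
    (hc : HasRank c a') : HasRank (b * c) (a + a') := by
  induction a using WellFoundedLT.induction generalizing b c a' with
  | ind a ih =>
    rcases eq_or_ne a 0 with rfl | ha
    · simpa using hb.mul_of_zero hc
    -- All powers of b are treated together, because the step to n + 1 uses the exponent n + 2 for
    -- series of rank below a'.
    have key : ∀ a', ∀ {c : nonposSeries K}, HasRank c a' → ∀ n : ℕ,
        HasRank (b ^ n * c) (n • a + a') := by
      intro a'
      induction a' using WellFoundedLT.induction with
      | ind a' ih' =>
        intro c hc n
        induction n with
        | zero => simpa using hc
        | succ n hn => exact hb.pow_succ_mul ha hc hn (fun r hr _ hx _ _ hy => ih r hr hx hy) ih'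
    simpa using key a' hc 1

/-- The negligible series form a prime ideal. -/
theorem mul_notMem_negligible [CharZero K] {b c : nonposSeries K} (hb : b ∉ negligible K)
    (hc : c ∉ negligible K) : b * c ∉ negligible K := by
  obtain ⟨_, hb⟩ := exists_hasRank hb
  obtain ⟨_, hc⟩ := exists_hasRank hc
  exact (hb.mul hc).notMem

end nonposSeries

/-! ### The supremum as a valuation. -/

section supremum

variable {K : Type*} [Field K]

theorem supSeries_eq_bot_iff {b : HahnSeries ℝ K} : supSeries b = ⊥ ↔ b = 0 := by
  rw [supSeries, sSup_eq_bot]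
  constructor
  · intro h
    ext x
    by_contra hx
    exact EReal.coe_ne_bot x (h _ ⟨x, hx, rfl⟩)
  · rintro rfl
    simp

theorem supSeries_eq_coe {b : HahnSeries ℝ K} (hb : b ≠ 0) {x : ℝ} (hx : IsLUB b.support x) :
    supSeries b = x := by
  have hne : b.support.Nonempty := HahnSeries.support_nonempty_iff.2 hb
  refine IsLUB.sSup_eq ⟨?_, fun y hy => ?_⟩
  · rintro _ ⟨z, hz, rfl⟩
    exact EReal.coe_le_coe_iff.2 (hx.1 hz)
  · induction y with
    | bot =>
      obtain ⟨z, hz⟩ := hne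
      exact absurd (hy ⟨z, hz, rfl⟩) (not_le.2 (EReal.bot_lt_coe z))
    | top => exact le_top
    | coe y =>
      exact EReal.coe_le_coe_iff.2 (hx.2 fun z hz => EReal.coe_le_coe_iff.1 (hy ⟨z, hz, rfl⟩))

theorem exists_isLUB_support {b : HahnSeries ℝ K} (hb : b ∈ nonposSeries K) (h0 : b ≠ 0) :
    ∃ x ≤ 0, IsLUB b.support x := by
  obtain ⟨x, hx⟩ := Real.exists_isLUB (HahnSeries.support_nonempty_iff.2 h0) ⟨0, hb⟩
  exact ⟨x, hx.2 hb, hx⟩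

theorem supSeries_add_le (b c : HahnSeries ℝ K) :
    supSeries (b + c) ≤ max (supSeries b) (supSeries c) := by
  refine sSup_le ?_
  rintro _ ⟨x, hx, rfl⟩
  rcases HahnSeries.support_add_subset b c hx with h | h
  · exact le_max_of_le_left (le_sSup ⟨x, h, rfl⟩)
  · exact le_max_of_le_right (le_sSup ⟨x, h, rfl⟩)

theorem isLUB_support_mul [CharZero K] {b c : HahnSeries ℝ K} {x y : ℝ}
    (hx : IsLUB b.support x) (hy : IsLUB c.support y) : IsLUB (b * c).support (x + y) := by
  have coeff_shift : ∀ (b : HahnSeries ℝ K) (x u : ℝ),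
      (HahnSeries.single (-x) 1 * b).coeff u = b.coeff (u + x) := by
    intro b x u
    have := HahnSeries.coeff_single_mul_add (r := (1 : K)) (x := b) (a := u + x) (b := -x)
    rwa [add_neg_cancel_right, one_mul] at this
  have mem : ∀ {b : HahnSeries ℝ K} {x : ℝ}, IsLUB b.support x →
      ∃ h : HahnSeries.single (-x) 1 * b ∈ nonposSeries K,
        (⟨_, h⟩ : nonposSeries K) ∉ nonposSeries.negligible K := by
    intro b x hx
    refine ⟨fun u hu => ?_, fun hmem => ?_⟩
    · have : u + x ≤ x := hx.1 (by rwa [HahnSeries.mem_support, coeff_shift] at hu)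
      rw [Set.mem_Iic]
      linarith
    · obtain ⟨l, hl, h⟩ := Real.eventually_nhdsLE_iff.1 hmem
      obtain ⟨z, hz, hlz, hzx⟩ := hx.exists_between (show l + x < x by linarith)
      refine hz ?_
      have := h (z - x) (by linarith) (by linarith)
      rwa [coeff_shift, sub_add_cancel] at this
  obtain ⟨hb, hb'⟩ := mem hx
  obtain ⟨hc, hc'⟩ := mem hy
  refine ⟨fun z hz => ?_, fun z hz => ?_⟩
  · obtain ⟨u, hu, v, hv, rfl⟩ := Set.mem_add.1 (HahnSeries.support_mul_subset hz)
    exact add_le_add (hx.1 hu) (hy.1 hv)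
  · by_contra! hlt
    -- An upper bound z below x + y would make the product of the two shifted series negligible.
    refine nonposSeries.mul_notMem_negligible hb' hc' (Real.eventually_nhdsLE_iff.2
      ⟨z - (x + y), by linarith, fun u hu _ => ?_⟩)
    by_contra hne
    refine absurd (hz (a := u + (x + y)) ?_) (not_le.2 (by linarith))
    rw [HahnSeries.mem_support, ← coeff_shift]
    convert hne using 2
    rw [Subring.coe_mul, mul_mul_mul_comm, HahnSeries.single_mul_single, one_mul, neg_add]

end supremum

/-- The first conjunct says that the supremum is a map from `K((ℝ^{≤0})) \ {0}` to `ℝ^{≤0}`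
(the least upper bound of the support in `ℝ`) and that it takes the value `-∞` exactly at `0`. -/
theorem mainTheorem9 (K : Type*) [Field K] [CharZero K] :
    (∀ b ∈ nonposSeries K,
      (supSeries b = ⊥ ↔ b = 0) ∧
      (b ≠ 0 → ∃ x : ℝ, x ≤ 0 ∧ IsLUB b.support x ∧ supSeries b = (x : EReal))) ∧
    (∀ b ∈ nonposSeries K, ∀ c ∈ nonposSeries K, b ≠ 0 → c ≠ 0 →
      supSeries (b + c) ≤ max (supSeries b) (supSeries c)) ∧
    (∀ b ∈ nonposSeries K, ∀ c ∈ nonposSeries K, b ≠ 0 → c ≠ 0 →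
      supSeries (b * c) = supSeries b + supSeries c) := by
  refine ⟨fun b hb => ⟨supSeries_eq_bot_iff, fun h0 => ?_⟩,
    fun b _ c _ _ _ => supSeries_add_le b c, fun b hb c hc hb0 hc0 => ?_⟩
  · obtain ⟨x, hx0, hx⟩ := exists_isLUB_support hb h0
    exact ⟨x, hx0, hx, supSeries_eq_coe h0 hx⟩
  · obtain ⟨x, -, hx⟩ := exists_isLUB_support hb hb0
    obtain ⟨y, -, hy⟩ := exists_isLUB_support hc hc0
    rw [supSeries_eq_coe hb0 hx, supSeries_eq_coe hc0 hy,
      supSeries_eq_coe (mul_ne_zero hb0 hc0) (isLUB_support_mul hx hy), EReal.coe_add]
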